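/- Let $A$ be a commutative Noetherian ring and let $R=\bigoplus_{i\ge 0}R_i$ be a commutative $\mathbb{N}$-graded $A$-algebra, finitely generated as an $A$-algebra, with $R_0=A$ (i.e. $A\to R_0$ is an isomorphism). For $\mathfrak p\in\operatorname{Spec}(A)$ let $\kappa(\mathfrak p)=A_{\mathfrak p}/\mathfrak pA_{\mathfrak p}$. We say that $R$ is *Artinian Gorenstein over $A$* if $R$ is a finitely generated flat $A$-module and the fiber $R\otimes_A\kappa(\mathfrak p)$ is a Gorenstein ring for every $\mathfrak p\in\operatorname{Spec}(A)$. (A commutative ring is Gorenstein if it is Noetherian and its localization at each prime ideal has finite injective dimension over itself.) When $R$ is a finitely generated $A$-module, we say that $R$ *satisfies Poincaré duality over $A$* if there are an integer $d\ge 0$ and an $A$-linear map $\rho\colon R\to A$ with $\rho(R_i)=0$ for all $i\neq d$ (that is, a graded map $R\to A(-d)$) such that the pairing $R\otimes_A R\to A$, $r_1\otimes r_2\mapsto\rho(r_1r_2)$, is perfect, i.e. $r_1\mapsto\rho(r_1\,\cdot\,)$ is an isomorphism $R\to\operatorname{Hom}_A(R,A)$. **Proposition.** Assume that one of the following conditions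 holds: (a) $A$ is a principal ideal domain; (b) $A$ is a polynomial ring in finitely many variables over a field; (c) every finitely generated projective $A$-module is free. Then $R$ is Artinian Gorenstein over $A$ if and only if $R$ is a finitely generated flat $A$-module that satisfies Poincaré duality over $A$. -/

import Mathlib

open CategoryTheory

universe u v

/-- A commutative ring is a *Gorenstein ring* if it is Noetherian and each of its localizations
at a prime ideal has finite injective dimension as a module over itself. -/
def IsGorensteinRing (S : Type u) [CommRing S] : Prop :=
  IsNoetherianRing S ∧ ∀ (q : Ideal S) [q.IsPrime], ∃ n : ℕ,
    HasInjectiveDimensionLE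
      (ModuleCat.of (Localization.AtPrime q) (Localization.AtPrime q)) n

/-- `R` is a *Gorenstein algebra* over `A`: it is `A`-flat and all its fibers
`κ(𝔭) ⊗[A] R`, for `𝔭` a prime ideal of `A`, are Gorenstein rings. -/
def IsGorensteinAlgebra (A : Type u) (R : Type v) [CommRing A] [CommRing R] [Algebra A R] :
    Prop :=
  Module.Flat A R ∧ ∀ (p : Ideal A) [p.IsPrime], IsGorensteinRing (p.Fiber R)

/-- `R` is an *Artinian Gorenstein algebra* over `A`: `Spec R ⟶ Spec A` is a finite Gorenstein
morphism. -/
def IsArtinianGorensteinAlgebra (A : Type u) (R : Type v) [CommRing A] [CommRing R]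
    [Algebra A R] : Prop :=
  Module.Finite A R ∧ IsGorensteinAlgebra A R

section PoincareDuality

variable {A : Type u} {R : Type v} [CommRing A] [CommRing R] [Algebra A R]

/-- An *orientation* `R → A(-d)`: a graded `A`-linear map, i.e. an `A`-linear map `R → A` which
vanishes on every graded part `𝒜 i` with `i ≠ d` (as `A(-d)` lives in degree `d` only). -/
def IsOrientation (𝒜 : ℕ → Submodule A R) (d : ℕ) (ρ : R →ₗ[A] A) : Prop :=
  ∀ i : ℕ, i ≠ d → ∀ r ∈ 𝒜 i, ρ r = 0

/-- The pairing `(r₁, r₂) ↦ ρ (r₁ * r₂)` on `R`. -/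
def orientationPairing (ρ : R →ₗ[A] A) : R →ₗ[A] R →ₗ[A] A :=
  (LinearMap.mul A R).compr₂ ρ

/-- The finite graded `A`-algebra `R` satisfies *Poincaré duality with respect to the orientation*
`ρ : R → A(-d)`: the pairing `(r₁, r₂) ↦ ρ (r₁ * r₂)` is perfect, i.e. it induces an isomorphism
of `R` with `Hom_A(R, A)`. -/
def SatisfiesPoincareDualityWith (𝒜 : ℕ → Submodule A R) (d : ℕ) (ρ : R →ₗ[A] A) : Prop :=
  IsOrientation 𝒜 d ρ ∧ (orientationPairing ρ).IsPerfPair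

/-- The finite graded `A`-algebra `R` satisfies *Poincaré duality over* `A`: it does so with
respect to some orientation `R → A(-d)`. (The value `d = 0` occurs, for nonzero `A`, only
for `R = A`.) -/
def SatisfiesPoincareDuality (𝒜 : ℕ → Submodule A R) : Prop :=
  ∃ (d : ℕ) (ρ : R →ₗ[A] A), SatisfiesPoincareDualityWith 𝒜 d ρ

end PoincareDuality

/-! When R is finite over A, each fibre S = κ(p) ⊗ R is local: R_0 = A makes κ(p) its residue field,
and its maximal ideal, generated by the positive degrees, is nilpotent. Over such a ring finite
injective dimension forces injectivity (`hasInjectiveDimensionLT_of_isNilpotent`), so a Gorenstein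
fibre has a one-dimensional socle (`IsGorensteinRing.exists_eq_smul`).

The top degree R_d is a projective summand of R whose fibres lie in these socles. The assumption on
A makes those fibres nonzero, hence lines, and trivialises the resulting line bundle
(`IsLineBundleTrivial`); ρ is the projection to R_d ≅ A. A nonzero element of S has a nonzero
multiple in the socle, where ρ is injective, so ρ is nondegenerate on fibres, and Nakayama makes it
perfect over A (`isPerfPair_of_forall_nondegenerate`).

Conversely, a perfect form stays nondegenerate on fibres, and a nondegenerate form makes a
finite-dimensional algebra self-injective (`injective_of_nondegenerate`). -/

/-! ### Injective dimension over rings with a nilpotent maximal ideal -/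

section InjectiveDimension

open Abelian

universe w

variable {S : Type w} [CommRing S]

/-- A module killed by a maximal ideal `m` embeds into a free module as soon as `S ⧸ m` embeds
into `S`. -/
lemma exists_injective_finsupp_of_isTorsionBySet (m : Ideal S) [m.IsMaximal] {x : S}
    (hx : ∀ s : S, s * x = 0 ↔ s ∈ m) (M : Type w) [AddCommGroup M] [Module S M]
    (hM : Module.IsTorsionBySet S M m) :
    ∃ (ι : Type w) (f : M →ₗ[S] ι →₀ S), Function.Injective f := by
  let _ : Field (S ⧸ m) := Ideal.Quotient.field m
  let _ : Module (S ⧸ m) M := hM.module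
  have : IsScalarTower S (S ⧸ m) M := hM.isScalarTower
  let j : (S ⧸ m) →ₗ[S] S :=
    Submodule.liftQ m (LinearMap.toSpanSingleton S S x) fun s hs ↦ by simpa using (hx s).2 hs
  have hj : Function.Injective j := by
    rw [← LinearMap.ker_eq_bot]
    refine Submodule.ker_liftQ_eq_bot _ _ _ fun s hs ↦ (hx s).1 (by simpa using hs)
  let b := Module.Free.chooseBasis (S ⧸ m) M
  refine ⟨_, (Finsupp.mapRange.linearMap j).comp (b.repr.toLinearMap.restrictScalars S), ?_⟩
  exact (Finsupp.mapRange_injective j (map_zero j) hj).comp b.repr.injective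

/-- Over a ring with a nilpotent maximal ideal, a module of finite injective dimension is
injective. -/
lemma hasInjectiveDimensionLT_of_isNilpotent (m : Ideal S) [m.IsMaximal] (hm : IsNilpotent m)
    {x : S} (hx : ∀ s : S, s * x = 0 ↔ s ∈ m) (X : ModuleCat.{w} S) (n : ℕ)
    [hX : HasInjectiveDimensionLT X (n + 2)] : HasInjectiveDimensionLT X (n + 1) := by
  have torsion (M : ModuleCat.{w} S) (hM : Module.IsTorsionBySet S M m) (e : Ext M X (n + 1)) :
      e = 0 := by
    obtain ⟨ι, f, hf⟩ := exists_injective_finsupp_of_isTorsionBySet m hx M hM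
    let T : ShortComplex (ModuleCat.{w} S) :=
      ModuleCat.shortComplexOfCompEqZero _ _ f.exact_map_mkQ_range.linearMap_comp_eq_zero
    have hT : T.ShortExact :=
      ModuleCat.shortComplex_shortExact T f.exact_map_mkQ_range hf (Submodule.mkQ_surjective _)
    have : Projective T.X₂ := ModuleCat.projective_of_free (Finsupp.basisSingleOne (R := S))
    -- With M inside a free module F, Ext^{n+2}(F/M, X) = 0 makes Ext^{n+1}(F, X) → Ext^{n+1}(M, X)
    -- onto, and the source vanishes since n + 1 ≥ 1.
    obtain ⟨y, rfl⟩ := Ext.contravariant_sequence_exact₁ hT X e (n₁ := n + 2) (by lia)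
      (Ext.eq_zero_of_hasInjectiveDimensionLT _ (n + 2) le_rfl)
    rw [Ext.eq_zero_of_projective y, Ext.comp_zero]
  -- Dévissage: if m^{j+1} M = 0, then m kills m^j M and m^j kills M / m^j M.
  have filtration (j : ℕ) : ∀ (M : ModuleCat.{w} S), (m ^ j • ⊤ : Submodule S M) = ⊥ →
      ∀ e : Ext M X (n + 1), e = 0 := by
    induction j with
    | zero =>
      intro M hM e
      have : Subsingleton M := (Submodule.subsingleton_iff S).1
        (subsingleton_of_bot_eq_top (by simpa using hM.symm))
      exact torsion M (fun _ _ ↦ Subsingleton.elim _ _) e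
    | succ j ih =>
      intro M hM e
      let N : Submodule S M := m ^ j • ⊤
      let T : ShortComplex (ModuleCat.{w} S) :=
        ModuleCat.shortComplexOfCompEqZero N.subtype N.mkQ (by ext; simp)
      have hT : T.ShortExact := ModuleCat.shortComplex_shortExact T
        (LinearMap.exact_subtype_mkQ N) N.subtype_injective N.mkQ_surjective
      obtain ⟨y, rfl⟩ := Ext.contravariant_sequence_exact₂ hT X e (torsion _ (fun z s ↦ by
        obtain ⟨z, hz⟩ := z
        ext
        have : (s : S) • z ∈ m • N := Submodule.smul_mem_smul s.2 hz
        rw [← Submodule.mul_smul, ← pow_succ', hM] at this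
        exact (Submodule.mem_bot S).1 this) _)
      rw [ih _ ?_ y, Ext.comp_zero]
      change (m ^ j • ⊤ : Submodule S (M ⧸ N)) = ⊥
      rw [← Submodule.range_mkQ N, ← Submodule.map_top, ← Submodule.map_smul'']
      exact Submodule.mkQ_map_self N
  obtain ⟨j, hj⟩ := hm
  refine HasInjectiveDimensionLT.mk fun i hi M e ↦ ?_
  obtain rfl | hi := hi.eq_or_lt
  · exact filtration j M (by rw [hj]; simp) e
  · exact Ext.eq_zero_of_hasInjectiveDimensionLT e (n + 2) hi

lemma injective_of_hasInjectiveDimensionLE_of_isNilpotent (m : Ideal S) [m.IsMaximal]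
    (hm : IsNilpotent m) {x : S} (hx : ∀ s : S, s * x = 0 ↔ s ∈ m) (M : Type w) [AddCommGroup M]
    [Module S M] (n : ℕ) (h : HasInjectiveDimensionLE (ModuleCat.of S M) n) :
    Module.Injective S M := by
  induction n with
  | zero =>
    rw [Module.injective_iff_injective_object]
    have : HasInjectiveDimensionLT (ModuleCat.of S M) 1 := h
    infer_instance
  | succ n ih =>
    have : HasInjectiveDimensionLT (ModuleCat.of S M) (n + 2) := h
    exact ih (hasInjectiveDimensionLT_of_isNilpotent m hm hx _ n)

/-- A nilpotent ideal annihilates an element `t * s` of each nonzero ideal `(s)`. -/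
lemma exists_mul_ne_zero_of_isNilpotent {m : Ideal S} (hm : IsNilpotent m) {s : S} (hs : s ≠ 0) :
    ∃ t : S, t * s ≠ 0 ∧ ∀ y ∈ m, y * (t * s) = 0 := by
  classical
  have h : ∃ j, ∀ y ∈ m ^ j, y * s = 0 := by
    obtain ⟨j, hj⟩ := hm
    exact ⟨j, fun y hy ↦ by
      rw [hj, Submodule.zero_eq_bot, Submodule.mem_bot] at hy
      simp [hy]⟩
  -- The least power of m killing s is not the zeroth, as s ≠ 0; t is taken in the power just below
  -- it.
  obtain ⟨j, hj⟩ : ∃ j, Nat.find h = j + 1 := Nat.exists_eq_succ_of_ne_zero fun h0 ↦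
    hs (by simpa using Nat.find_spec h 1 (by simp [h0]))
  have := Nat.find_min h (m := j) (by lia)
  push Not at this
  obtain ⟨t, ht, hts⟩ := this
  refine ⟨t, hts, fun y hy ↦ ?_⟩
  rw [← mul_assoc]
  exact Nat.find_spec h _ (by rw [hj, pow_succ']; exact Ideal.mul_mem_mul hy ht)

/-- In a self-injective ring, the elements annihilated by a maximal ideal generate each other. -/
lemma exists_eq_mul_of_injective [Module.Injective S S] (m : Ideal S) {x y : S}
    (hx : ∀ s : S, s * x = 0 ↔ s ∈ m) (hy : ∀ s ∈ m, s * y = 0) : ∃ c : S, y = c * x := by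
  let f : (S ⧸ m) →ₗ[S] S :=
    Submodule.liftQ m (LinearMap.toSpanSingleton S S x) fun s hs ↦ by simpa using (hx s).2 hs
  let g : (S ⧸ m) →ₗ[S] S :=
    Submodule.liftQ m (LinearMap.toSpanSingleton S S y) fun s hs ↦ by simpa using hy s hs
  have hf : Function.Injective f := by
    rw [← LinearMap.ker_eq_bot]
    refine Submodule.ker_liftQ_eq_bot _ _ _ fun s hs ↦ (hx s).1 (by simpa using hs)
  obtain ⟨h, hh⟩ := Module.Injective.out f hf g
  refine ⟨h 1, ?_⟩
  have h1 := hh (m.mkQ 1)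
  have hf1 : f (m.mkQ 1) = x := (Submodule.liftQ_apply _ _ _).trans (by simp)
  have hg1 : g (m.mkQ 1) = y := (Submodule.liftQ_apply _ _ _).trans (by simp)
  rw [hf1, hg1] at h1
  rw [← h1, mul_comm, ← smul_eq_mul, ← map_smul, smul_eq_mul, mul_one]

/-- A Noetherian self-injective ring is Gorenstein. -/
lemma IsGorensteinRing.of_injective [IsNoetherianRing S] [Module.Injective S S] :
    IsGorensteinRing S := by
  refine ⟨inferInstance, fun q _ ↦ ⟨0, ?_⟩⟩
  have : Module.Injective (Localization.AtPrime q) (Localization.AtPrime q) :=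
    Module.injective_of_isLocalizedModule q.primeCompl (Algebra.linearMap S _)
  rw [Module.injective_iff_injective_object] at this
  change HasInjectiveDimensionLT _ 1
  infer_instance

attribute [local instance] RingHomInvPair.of_ringEquiv in
/-- A Gorenstein ring whose elements outside some nilpotent ideal are units is self-injective. -/
lemma IsGorensteinRing.injective (h : IsGorensteinRing S) (m : Ideal S) [m.IsMaximal]
    (hm : IsNilpotent m) (hu : ∀ s ∉ m, IsUnit s) {x : S} (hx : ∀ s : S, s * x = 0 ↔ s ∈ m) :
    Module.Injective S S := by
  obtain ⟨n, hn⟩ := h.2 m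
  -- Inverting elements that are already units changes nothing.
  let e : S ≃+* Localization.AtPrime m :=
    (IsLocalization.atUnits S m.primeCompl fun s hs ↦ hu s hs).toRingEquiv
  let e' : S ≃ₛₗ[RingHomClass.toRingHom e] Localization.AtPrime m :=
    { e.toAddEquiv with map_smul' := fun a b ↦ map_mul e a b }
  refine injective_of_hasInjectiveDimensionLE_of_isNilpotent m hm hx S n ?_
  exact (ModuleCat.hasInjectiveDimensionLE_iff_of_semiLinearEquiv (M := ModuleCat.of S S)
    (N := ModuleCat.of (Localization.AtPrime m) (Localization.AtPrime m)) e e' n).2 hn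

end InjectiveDimension

/-! ### Socles and nondegenerate forms on algebras over a field -/

section LocalAlgebra

variable {k : Type u} {S : Type v} [Field k] [CommRing S] [Algebra k S]

/-- Such an s is a nonzero constant plus a nilpotent. -/
lemma isUnit_of_notMem_of_isNilpotent {m : Ideal S} (hm : IsNilpotent m)
    (hk : ∀ s : S, ∃ c : k, s - algebraMap k S c ∈ m) {s : S} (hs : s ∉ m) : IsUnit s := by
  obtain ⟨c, hc⟩ := hk s
  have hc0 : c ≠ 0 := by
    rintro rfl
    exact hs (by simpa using hc)
  have hnil : IsNilpotent (s - algebraMap k S c) := by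
    obtain ⟨j, hj⟩ := hm
    exact ⟨j, by simpa [hj] using Ideal.pow_mem_pow hc j⟩
  have := hnil.isUnit_add_right_of_commute (hc0.isUnit.map (algebraMap k S)) (Commute.all _ _)
  simpa using this

lemma isMaximal_of_isNilpotent [Nontrivial S] {m : Ideal S} (hm : IsNilpotent m)
    (hk : ∀ s : S, ∃ c : k, s - algebraMap k S c ∈ m) : m.IsMaximal := by
  rw [Ideal.isMaximal_iff]
  refine ⟨fun h ↦ ?_, fun J s _ hs hJ ↦
    (Ideal.eq_top_iff_one J).1 (J.eq_top_of_isUnit_mem hJ (isUnit_of_notMem_of_isNilpotent hm hk hs))⟩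
  obtain ⟨j, hj⟩ := hm
  exact one_ne_zero (by simpa [hj] using Ideal.pow_mem_pow h j : (1 : S) = 0)

lemma mul_eq_zero_iff_mem_of_isNilpotent {m : Ideal S} (hm : IsNilpotent m)
    (hk : ∀ s : S, ∃ c : k, s - algebraMap k S c ∈ m) {x : S} (hx : x ≠ 0)
    (hmx : ∀ s ∈ m, s * x = 0) (s : S) : s * x = 0 ↔ s ∈ m := by
  refine ⟨fun h ↦ ?_, hmx s⟩
  by_contra hs
  exact hx ((isUnit_of_notMem_of_isNilpotent hm hk hs).mul_right_eq_zero.1 h)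

/-- The socle of a local Gorenstein algebra with nilpotent maximal ideal `m` and residue field `k`
is one-dimensional. -/
lemma IsGorensteinRing.exists_eq_smul (h : IsGorensteinRing S) {m : Ideal S} (hm : IsNilpotent m)
    (hk : ∀ s : S, ∃ c : k, s - algebraMap k S c ∈ m) {x y : S} (hx : x ≠ 0)
    (hmx : ∀ s ∈ m, s * x = 0) (hmy : ∀ s ∈ m, s * y = 0) : ∃ c : k, y = c • x := by
  have : Nontrivial S := nontrivial_of_ne x 0 hx
  have := isMaximal_of_isNilpotent hm hk
  have hx' := mul_eq_zero_iff_mem_of_isNilpotent hm hk hx hmx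
  have := h.injective m hm (fun s ↦ isUnit_of_notMem_of_isNilpotent hm hk) hx'
  obtain ⟨c, rfl⟩ := exists_eq_mul_of_injective m hx' hmy
  obtain ⟨c', hc'⟩ := hk c
  refine ⟨c', ?_⟩
  rw [Algebra.smul_def, ← sub_eq_zero, ← sub_mul]
  exact hmx _ hc'

/-- Nondegeneracy embeds S in its dual, which has the same finite dimension. -/
lemma exists_dual_apply_eq_of_nondegenerate [Module.Finite k S] (ρ : S →ₗ[k] k)
    (hρ : ∀ s : S, (∀ t : S, ρ (s * t) = 0) → s = 0) (f : Module.Dual k S) :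
    ∃ c : S, ∀ t : S, f t = ρ (c * t) := by
  let φ : S →ₗ[k] Module.Dual k S := (LinearMap.mul k S).compr₂ ρ
  have hφ : Function.Injective φ :=
    (injective_iff_map_eq_zero _).2 fun s hs ↦ hρ s fun t ↦ LinearMap.congr_fun hs t
  obtain ⟨c, rfl⟩ := (LinearMap.injective_iff_surjective_of_finrank_eq_finrank
      (Subspace.dual_finrank_eq (K := k) (V := S)).symm).1 hφ f
  exact ⟨c, fun _ ↦ rfl⟩

/-- A finite-dimensional algebra with a nondegenerate form `(s, t) ↦ ρ (s * t)` is
self-injective. -/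
lemma injective_of_nondegenerate [Module.Finite k S] (ρ : S →ₗ[k] k)
    (hρ : ∀ s : S, (∀ t : S, ρ (s * t) = 0) → s = 0) : Module.Injective S S := by
  refine Module.Baer.injective fun J f ↦ ?_
  -- For Baer's criterion, extend ρ ∘ f from J to all of S and write it as ρ(c ·); nondegeneracy
  -- then forces f to be multiplication by c.
  obtain ⟨g, hg⟩ := LinearMap.exists_extend (p := J.restrictScalars k)
    (ρ ∘ₗ f.restrictScalars k : J.restrictScalars k →ₗ[k] k)
  obtain ⟨c, hc⟩ := exists_dual_apply_eq_of_nondegenerate ρ hρ g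
  refine ⟨LinearMap.mulLeft S c, fun x hx ↦ ?_⟩
  rw [← sub_eq_zero]
  refine hρ _ fun t ↦ ?_
  have := LinearMap.congr_fun hg ⟨t * x, J.mul_mem_left t hx⟩
  have hf : f ⟨t * x, J.mul_mem_left t hx⟩ = t * f ⟨x, hx⟩ := by
    rw [← smul_eq_mul (a := t) (b := f _), ← map_smul]
    rfl
  have h2 : ρ (c * (t * x)) = ρ (t * f ⟨x, hx⟩) := by
    rw [← hf, ← hc]
    exact this
  rw [sub_mul, map_sub, sub_eq_zero, LinearMap.mulLeft_apply, mul_assoc, mul_comm x, h2, mul_comm t]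

/-- A finite-dimensional algebra with a nondegenerate form `(s, t) ↦ ρ (s * t)` is Gorenstein. -/
lemma IsGorensteinRing.of_nondegenerate [Module.Finite k S] (ρ : S →ₗ[k] k)
    (hρ : ∀ s : S, (∀ t : S, ρ (s * t) = 0) → s = 0) : IsGorensteinRing S := by
  have := injective_of_nondegenerate ρ hρ
  have := IsNoetherianRing.of_finite k S
  exact .of_injective

end LocalAlgebra

/-! ### Triviality of line bundles -/

section LineBundle

open TensorProduct

variable {A : Type u} {T : Type v} [CommRing A] [AddCommGroup T] [Module A T]

/-- A finite projective module has a finite dual basis. -/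
lemma exists_finite_dual_basis (A : Type u) (T : Type v) [CommRing A] [AddCommGroup T] [Module A T]
    [Module.Finite A T] [Module.Projective A T] :
    ∃ (n : ℕ) (e : Fin n → T) (g : Fin n → Module.Dual A T), ∀ t, ∑ i, g i t • e i = t := by
  obtain ⟨n, f, g, -, -, hfg⟩ := Module.Finite.exists_comp_eq_id_of_projective A T
  refine ⟨n, fun i ↦ f (Pi.single i 1), fun i ↦ LinearMap.proj i ∘ₗ g, fun t ↦ ?_⟩
  simp_rw [← map_smul, ← map_sum]
  conv_rhs => rw [← LinearMap.id_apply (R := A) t, ← hfg, LinearMap.comp_apply]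
  congr 1
  ext j
  simp [Pi.single_apply]

/-- A finite projective module with nonzero fibres has a surjective trace. -/
lemma contractLeft_surjective_of_nontrivial_fiber [Module.Finite A T] [Module.Projective A T]
    (h : ∀ (p : Ideal A) [p.IsPrime], Nontrivial (p.Fiber T)) :
    Function.Surjective (contractLeft A T) := by
  rw [← LinearMap.range_eq_top]
  by_contra hne
  -- If the trace ideal lies in p, all coordinates in a dual basis vanish at p, so the fibre at p is
  -- zero.
  obtain ⟨p, hp, hle⟩ := Ideal.exists_le_maximal _ hne
  have hmem (f : Module.Dual A T) (t : T) : algebraMap A p.ResidueField (f t) = 0 := by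
    rw [Ideal.algebraMap_residueField_eq_zero]
    exact hle ⟨f ⊗ₜ t, contractLeft_apply f t⟩
  obtain ⟨n, e, g, heg⟩ := exists_finite_dual_basis A T
  have := h p
  refine not_subsingleton (p.Fiber T) (subsingleton_of_forall_eq 0 fun z ↦ ?_)
  induction z using TensorProduct.induction_on with
  | zero => rfl
  | add x y hx hy => rw [hx, hy, add_zero]
  | tmul c t =>
    rw [← heg t, tmul_sum]
    refine Finset.sum_eq_zero fun i _ ↦ ?_
    rw [← smul_tmul, Algebra.smul_def, hmem, zero_mul, zero_tmul]

/-- For x ≠ 0, rank one gives a • y = b • x with a ≠ 0; the identity holds after scaling by a, which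
torsion-freeness cancels. -/
lemma dual_smul_comm_of_finrank_eq_one [IsDomain A] [Module.IsTorsionFree A T] [Module.Finite A T]
    (h : Module.finrank A T = 1) (f : Module.Dual A T) (x y : T) : f x • y = f y • x := by
  by_cases hx : x = 0
  · simp [hx]
  obtain ⟨a, b, ha, hab⟩ : ∃ a b : A, a ≠ 0 ∧ a • y = b • x := by
    have hli : ¬ LinearIndependent A ![x, y] := fun hli ↦ by
      have := hli.cardinal_lift_le_rank
      rw [Module.rank_eq_one_iff_finrank_eq_one.2 h] at this
      simp at this
    rw [LinearIndependent.pair_iff] at hli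
    push Not at hli
    obtain ⟨s, t, hst, h0⟩ := hli
    refine ⟨t, -s, fun ht ↦ ?_, ?_⟩
    · subst ht
      exact h0 ((smul_eq_zero.1 (by simpa using hst)).resolve_right hx) rfl
    · rw [neg_smul, eq_neg_iff_add_eq_zero, add_comm, hst]
  refine smul_right_injective T ha ?_
  have := congrArg f hab
  simp only [map_smul, smul_eq_mul] at this
  simp only
  rw [smul_comm, hab, ← mul_smul, ← mul_smul, this, mul_comm]

/-- In rank one the contraction c satisfies c(w) z = c(z) w; choosing c(w) = 1 shows that its kernel
is zero. -/
lemma contractLeft_injective_of_finrank_eq_one [IsDomain A] [Module.Finite A T]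
    [Module.IsTorsionFree A T] (h : Module.finrank A T = 1)
    (hs : Function.Surjective (contractLeft A T)) :
    Function.Injective (contractLeft A T) := by
  have key (w z : Module.Dual A T ⊗[A] T) : contractLeft A T w • z = contractLeft A T z • w := by
    induction w with
    | zero => simp
    | add w₁ w₂ h₁ h₂ => rw [map_add, add_smul, h₁, h₂, smul_add]
    | tmul f t =>
      induction z with
      | zero => simp
      | add z₁ z₂ h₁ h₂ => rw [map_add, add_smul, ← h₁, ← h₂, smul_add]
      | tmul g u =>
        have hfg : f u • g = g u • f := by
          ext x
          have := congrArg g (dual_smul_comm_of_finrank_eq_one h f u x)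
          simpa [mul_comm] using this
        rw [contractLeft_apply, contractLeft_apply, ← tmul_smul,
          dual_smul_comm_of_finrank_eq_one h f t u, ← smul_tmul, hfg, smul_tmul']
  refine (injective_iff_map_eq_zero _).2 fun z hz ↦ ?_
  obtain ⟨w, hw⟩ := hs 1
  simpa [hw, hz] using key w z

/-- Bijectivity of the contraction makes T invertible, and invertible modules over a GCD domain are
free. -/
lemma nonempty_linearEquiv_of_finrank_eq_one [IsDomain A] [UniqueFactorizationMonoid A]
    [Module.Finite A T] [Module.Projective A T] (h : Module.finrank A T = 1) :
    Nonempty (T ≃ₗ[A] A) := by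
  have hs : Function.Surjective (contractLeft A T) :=
    contractLeft_surjective_of_nontrivial_fiber fun p _ ↦
      Module.nontrivial_of_finrank_pos (R := p.ResidueField)
        (by rw [Ideal.finrank_fiber_eq_finrank, h]; exact one_pos)
  have : Module.Invertible A T := ⟨contractLeft_injective_of_finrank_eq_one h hs, hs⟩
  have : IsGCDMonoid A := ⟨UniqueFactorizationMonoid.toGCDMonoid A⟩
  exact Module.Invertible.free_iff_linearEquiv.1 inferInstance

/-- Moves the freeness hypothesis from the universe of A to that of T, through a model of T in the
former. -/
lemma Module.free_of_forall_free_of_finite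
    (hA : ∀ (P : Type u) [AddCommGroup P] [Module A P],
      Module.Finite A P → Module.Projective A P → Module.Free A P)
    [Module.Finite A T] [Module.Projective A T] : Module.Free A T := by
  let e := Module.Finite.reprEquiv A T
  have := hA (Module.Finite.repr A T) (.equiv e.symm) (.of_equiv e.symm)
  exact .of_equiv e

/-- A ring for which nonzero finite projective modules have nonzero fibres, and those with
one-dimensional fibres are free. -/
structure IsLineBundleTrivial (A : Type u) [CommRing A] : Prop where
  nontrivial_fiber (T : Type v) [AddCommGroup T] [Module A T] [Module.Finite A T]
    [Module.Projective A T] [Nontrivial T] (p : Ideal A) [p.IsPrime] : Nontrivial (p.Fiber T)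
  nonempty_linearEquiv (T : Type v) [AddCommGroup T] [Module A T] [Module.Finite A T]
    [Module.Projective A T]
    (h : ∀ (p : Ideal A) [p.IsPrime], Module.finrank p.ResidueField (p.Fiber T) = 1) :
    Nonempty (T ≃ₗ[A] A)

/-- Serves both principal ideal domains and polynomial rings: only rank one modules need to be free,
so Quillen–Suslin is not required. -/
lemma IsLineBundleTrivial.of_uniqueFactorizationMonoid [IsDomain A] [UniqueFactorizationMonoid A] :
    IsLineBundleTrivial.{u, v} A where
  nontrivial_fiber T _ _ _ _ _ p _ := by
    refine Module.nontrivial_of_finrank_pos (R := p.ResidueField) ?_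
    rw [Ideal.finrank_fiber_eq_finrank]
    exact Module.finrank_pos
  nonempty_linearEquiv T _ _ _ _ h := by
    refine nonempty_linearEquiv_of_finrank_eq_one ?_
    rw [← Ideal.finrank_fiber_eq_finrank (⊥ : Ideal A), h]

lemma IsLineBundleTrivial.of_forall_free [Nontrivial A]
    (hA : ∀ (P : Type u) [AddCommGroup P] [Module A P],
      Module.Finite A P → Module.Projective A P → Module.Free A P) :
    IsLineBundleTrivial.{u, v} A where
  nontrivial_fiber T _ _ _ _ _ p _ := by
    have : Module.Free A T := Module.free_of_forall_free_of_finite hA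
    infer_instance
  nonempty_linearEquiv T _ _ _ _ h := by
    have : Module.Free A T := Module.free_of_forall_free_of_finite hA
    obtain ⟨p, hp⟩ := Ideal.exists_maximal A
    refine Module.nonempty_linearEquiv_of_finrank_eq_one ?_ |>.map LinearEquiv.symm
    rw [← h p, Module.finrank_baseChange]

end LineBundle

/-! ### The fibres of a graded algebra and their top degree -/

section GradedFiber

open TensorProduct DirectSum

variable {A : Type u} {R : Type v} [CommRing A] [CommRing R] [Algebra A R]
  (𝒜 : ℕ → Submodule A R) [GradedAlgebra 𝒜]

lemma exists_top_degree [IsNoetherian A R] [Nontrivial (𝒜 0)] :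
    ∃ d, Nontrivial (𝒜 d) ∧ ∀ i, d < i → 𝒜 i = ⊥ := by
  have hfin : {i | 𝒜 i ≠ ⊥}.Finite := WellFoundedGT.finite_ne_bot_of_iSupIndep
    (DirectSum.Decomposition.isInternal 𝒜).submodule_iSupIndep
  obtain ⟨d, hd, hmax⟩ := hfin.exists_maximal ⟨0, (Submodule.nontrivial_iff_ne_bot).1 ‹_›⟩
  refine ⟨d, (Submodule.nontrivial_iff_ne_bot).2 hd, fun i hi ↦ ?_⟩
  by_contra h
  exact hi.not_ge (hmax h hi.le)

lemma isNilpotent_irrelevant [IsNoetherianRing R] {d : ℕ} (hd : ∀ i, d < i → 𝒜 i = ⊥) :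
    IsNilpotent (HomogeneousIdeal.irrelevant 𝒜).toIdeal := by
  classical
  have hle : (HomogeneousIdeal.irrelevant 𝒜).toIdeal ≤ nilradical R := fun x hx ↦ by
    rw [← DirectSum.sum_support_decompose 𝒜 x]
    refine Ideal.sum_mem _ fun i _ ↦ ?_
    obtain rfl | hi := Nat.eq_zero_or_pos i
    · have h0 : (decompose 𝒜 x 0 : R) = 0 := hx
      rw [h0]
      exact zero_mem _
    -- The power has degree (d + 1) i > d, since i ≥ 1.
    · refine ⟨d + 1, ?_⟩
      have := SetLike.pow_mem_graded (d + 1) (decompose 𝒜 x i).2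
      rwa [hd _ (by rw [smul_eq_mul]; nlinarith), Submodule.mem_bot] at this
  obtain ⟨n, hn⟩ := IsNoetherianRing.isNilpotent_nilradical R
  exact ⟨n, le_bot_iff.1 ((Ideal.pow_right_mono hle n).trans hn.le)⟩

lemma mul_eq_zero_of_mem_irrelevant {d : ℕ} (hd : ∀ i, d < i → 𝒜 i = ⊥) {s t : R}
    (hs : s ∈ HomogeneousIdeal.irrelevant 𝒜) (ht : t ∈ 𝒜 d) : s * t = 0 := by
  classical
  rw [← DirectSum.sum_support_decompose 𝒜 s, Finset.sum_mul]
  refine Finset.sum_eq_zero fun i _ ↦ ?_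
  obtain rfl | hi := Nat.eq_zero_or_pos i
  · have h0 : (decompose 𝒜 s 0 : R) = 0 := hs
    rw [h0, zero_mul]
  · have := SetLike.mul_mem_graded (decompose 𝒜 s i).2 ht
    rwa [hd _ (by lia), Submodule.mem_bot] at this

variable (K : Type*) [Field K] [Algebra A K]

/-- The extension of the irrelevant ideal of `R` to the base change `K ⊗[A] R`. -/
def irrelevantBaseChange : Ideal (K ⊗[A] R) :=
  (HomogeneousIdeal.irrelevant 𝒜).toIdeal.map
    (Algebra.TensorProduct.includeRight : R →ₐ[A] K ⊗[A] R)

lemma isNilpotent_irrelevantBaseChange [IsNoetherianRing R] {d : ℕ}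
    (hd : ∀ i, d < i → 𝒜 i = ⊥) : IsNilpotent (irrelevantBaseChange 𝒜 K) := by
  obtain ⟨n, hn⟩ := isNilpotent_irrelevant 𝒜 hd
  refine ⟨n, ?_⟩
  rw [irrelevantBaseChange, ← Ideal.map_pow, hn]
  exact Ideal.map_bot

lemma exists_sub_mem_irrelevantBaseChange (h0 : Function.Surjective (algebraMap A (𝒜 0)))
    (s : K ⊗[A] R) : ∃ c : K, s - algebraMap K (K ⊗[A] R) c ∈ irrelevantBaseChange 𝒜 K := by
  induction s with
  | zero => exact ⟨0, by simp⟩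
  | add x y hx hy =>
    obtain ⟨a, ha⟩ := hx
    obtain ⟨b, hb⟩ := hy
    refine ⟨a + b, ?_⟩
    rw [map_add, add_sub_add_comm]
    exact add_mem ha hb
  | tmul c r =>
    obtain ⟨a, ha⟩ := h0 (decompose 𝒜 r 0)
    have ha' : algebraMap A R a = decompose 𝒜 r 0 := congrArg Subtype.val ha
    -- With a the degree 0 part of r, the difference is c ⊗ (r - a), and r - a is irrelevant.
    refine ⟨a • c, ?_⟩
    have : c ⊗ₜ[A] r - algebraMap K (K ⊗[A] R) (a • c) =
        c ⊗ₜ[A] 1 * (Algebra.TensorProduct.includeRight : R →ₐ[A] K ⊗[A] R)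
          (r - algebraMap A R a) := by
      rw [Algebra.TensorProduct.includeRight_apply, Algebra.TensorProduct.tmul_mul_tmul, mul_one,
        one_mul, tmul_sub, Algebra.TensorProduct.algebraMap_apply, Algebra.algebraMap_self_apply,
        Algebra.algebraMap_eq_smul_one, ← smul_tmul]
    rw [this]
    refine Ideal.mul_mem_left _ _ (Ideal.mem_map_of_mem _ ?_)
    change ((decompose 𝒜 (r - algebraMap A R a) 0 : 𝒜 0) : R) = 0
    rw [decompose_sub, ha', DirectSum.sub_apply, decompose_coe, of_eq_same, sub_self,
      ZeroMemClass.coe_zero]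

lemma mul_baseChange_eq_zero {d : ℕ} (hd : ∀ i, d < i → 𝒜 i = ⊥) (z : K ⊗[A] 𝒜 d)
    {s : K ⊗[A] R} (hs : s ∈ irrelevantBaseChange 𝒜 K) :
    s * (𝒜 d).subtype.baseChange K z = 0 := by
  suffices irrelevantBaseChange 𝒜 K ≤ LinearMap.ker
      (LinearMap.toSpanSingleton (K ⊗[A] R) (K ⊗[A] R) ((𝒜 d).subtype.baseChange K z)) by
    simpa using this hs
  refine Ideal.map_le_iff_le_comap.2 fun r hr ↦ ?_
  change (1 : K) ⊗ₜ[A] r * _ = 0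
  induction z with
  | zero => simp
  | add x y hx hy => rw [map_add, mul_add, hx, hy, add_zero]
  | tmul c t =>
    rw [LinearMap.baseChange_tmul, Algebra.TensorProduct.tmul_mul_tmul, Submodule.subtype_apply,
      mul_eq_zero_of_mem_irrelevant 𝒜 hd hr t.2, tmul_zero]

/-- The projection of a graded algebra onto its degree `d` part. -/
def gradedComponent (d : ℕ) : R →ₗ[A] 𝒜 d :=
  DirectSum.component A ℕ (fun i ↦ 𝒜 i) d ∘ₗ (decomposeLinearEquiv 𝒜).toLinearMap

lemma gradedComponent_comp_subtype (d : ℕ) :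
    gradedComponent 𝒜 d ∘ₗ (𝒜 d).subtype = LinearMap.id := by
  ext x
  simp [gradedComponent, component.lof_self]

lemma gradedComponent_of_ne {d i : ℕ} (h : i ≠ d) {r : R} (hr : r ∈ 𝒜 i) :
    gradedComponent 𝒜 d r = 0 := by
  ext
  exact decompose_of_mem_ne 𝒜 hr h

/-- The degree d part is a direct summand, so the retraction survives base change. -/
lemma baseChange_subtype_injective (d : ℕ) :
    Function.Injective ((𝒜 d).subtype.baseChange K) := by
  refine Function.LeftInverse.injective (g := (gradedComponent 𝒜 d).baseChange K) fun z ↦ ?_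
  rw [← LinearMap.comp_apply, ← LinearMap.baseChange_comp, gradedComponent_comp_subtype,
    LinearMap.baseChange_id]
  rfl

/-- The base change to `K` of a linear form. -/
noncomputable def formBaseChange (ρ : R →ₗ[A] A) : K ⊗[A] R →ₗ[K] K :=
  (Algebra.linearMap A K ∘ₗ ρ).liftBaseChange K

lemma formBaseChange_tmul (ρ : R →ₗ[A] A) (c : K) (r : R) :
    formBaseChange K ρ (c ⊗ₜ r) = c * algebraMap A K (ρ r) := by
  simp [formBaseChange]

lemma formBaseChange_injective {d : ℕ} (e : 𝒜 d ≃ₗ[A] A) :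
    Function.Injective (formBaseChange K (e.toLinearMap ∘ₗ gradedComponent 𝒜 d) ∘ₗ
      (𝒜 d).subtype.baseChange K) := by
  have : formBaseChange K (e.toLinearMap ∘ₗ gradedComponent 𝒜 d) ∘ₗ (𝒜 d).subtype.baseChange K =
      (AlgebraTensorModule.rid A K K).toLinearMap ∘ₗ e.toLinearMap.baseChange K := by
    ext x
    have hx : gradedComponent 𝒜 d x = x :=
      LinearMap.congr_fun (gradedComponent_comp_subtype 𝒜 d) x
    simp [formBaseChange_tmul, hx, Algebra.algebraMap_eq_smul_one]
  rw [this]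
  exact (AlgebraTensorModule.rid A K K).injective.comp (e.baseChange A K _ _).injective

variable {K} in
-- The top degree is killed by the maximal ideal, so it is a nonzero subspace of a one-dimensional
-- socle.
lemma finrank_fiber_top_degree_eq_one [IsNoetherianRing R]
    (h0 : Function.Surjective (algebraMap A (𝒜 0))) {d : ℕ} (hd : ∀ i, d < i → 𝒜 i = ⊥)
    [Nontrivial (K ⊗[A] 𝒜 d)] (hG : IsGorensteinRing (K ⊗[A] R)) :
    Module.finrank K (K ⊗[A] 𝒜 d) = 1 := by
  obtain ⟨z, hz⟩ := exists_ne (0 : K ⊗[A] 𝒜 d)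
  refine (finrank_eq_one_iff_of_nonzero' z hz).2 fun w ↦ ?_
  have hinj := baseChange_subtype_injective 𝒜 K d
  obtain ⟨c, hc⟩ := hG.exists_eq_smul (isNilpotent_irrelevantBaseChange 𝒜 K hd)
    (exists_sub_mem_irrelevantBaseChange 𝒜 K h0) (mt (fun h ↦ hinj (h.trans (map_zero _).symm)) hz)
    (fun s ↦ mul_baseChange_eq_zero 𝒜 K hd z) (fun s ↦ mul_baseChange_eq_zero 𝒜 K hd w)
  refine ⟨c, hinj ?_⟩
  rw [map_smul, hc]

variable {K} in
-- A nonzero s would have a nonzero multiple in the socle, which is spanned by a top degree element;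
-- the form is injective there.
lemma formBaseChange_nondegenerate [IsNoetherianRing R]
    (h0 : Function.Surjective (algebraMap A (𝒜 0))) {d : ℕ} (hd : ∀ i, d < i → 𝒜 i = ⊥)
    [Nontrivial (K ⊗[A] 𝒜 d)] (hG : IsGorensteinRing (K ⊗[A] R)) (e : 𝒜 d ≃ₗ[A] A)
    (s : K ⊗[A] R)
    (hs : ∀ t, formBaseChange K (e.toLinearMap ∘ₗ gradedComponent 𝒜 d) (s * t) = 0) : s = 0 := by
  by_contra hs0
  obtain ⟨z, hz⟩ := exists_ne (0 : K ⊗[A] 𝒜 d)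
  have hm := isNilpotent_irrelevantBaseChange 𝒜 K hd
  obtain ⟨t, hts, ht⟩ := exists_mul_ne_zero_of_isNilpotent hm hs0
  obtain ⟨c, hc⟩ := hG.exists_eq_smul hm (exists_sub_mem_irrelevantBaseChange 𝒜 K h0)
    (mt (fun h ↦ baseChange_subtype_injective 𝒜 K d (h.trans (map_zero _).symm)) hz)
    (fun s ↦ mul_baseChange_eq_zero 𝒜 K hd z) ht
  have h := hs t
  rw [mul_comm, hc, ← map_smul, ← LinearMap.comp_apply] at h
  have hcz := formBaseChange_injective 𝒜 K e (h.trans (map_zero _).symm)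
  rw [← map_smul, hcz, map_zero] at hc
  exact hts hc

end GradedFiber

/-! ### Perfect pairings and passage between A and its residue fields -/

section Pairing

open TensorProduct

variable {A : Type u} {R : Type v} [CommRing A] [CommRing R] [Algebra A R]

/-- Nakayama at a maximal p containing the annihilator of M / N yields r ≡ 1 mod p in that
annihilator, a contradiction. -/
lemma Submodule.eq_top_of_forall_isMaximal {M : Type*} [AddCommGroup M] [Module A M]
    [Module.Finite A M] (N : Submodule A M)
    (h : ∀ (p : Ideal A) [p.IsMaximal], (⊤ : Submodule A M) ≤ N ⊔ p • ⊤) : N = ⊤ := by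
  by_contra hN
  have hne : Module.annihilator A (M ⧸ N) ≠ ⊤ := fun h ↦ hN <| by
    exact Submodule.Quotient.subsingleton_iff.1 (Module.annihilator_eq_top_iff.1 h)
  obtain ⟨p, hp, hle⟩ := Ideal.exists_le_maximal _ hne
  have htop : (⊤ : Submodule A (M ⧸ N)) ≤ p • ⊤ := by
    rw [← N.range_mkQ, ← Submodule.map_top, ← Submodule.map_smul'']
    refine (Submodule.map_mono (h p)).trans ?_
    rw [Submodule.map_sup, Submodule.mkQ_map_self, bot_sup_eq]
  obtain ⟨r, hr, hr'⟩ :=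
    Submodule.exists_sub_one_mem_and_smul_eq_zero_of_fg_of_le_smul p _ Module.Finite.fg_top htop
  have hrp : r ∈ p := hle (Module.mem_annihilator.2 fun x ↦ hr' x trivial)
  exact hp.ne_top ((Ideal.eq_top_iff_one p).2 (by simpa using sub_mem hrp hr))

lemma orientationPairing_apply (ρ : R →ₗ[A] A) (r s : R) :
    orientationPairing ρ r s = ρ (r * s) := rfl

/-- A form on a finite projective algebra is perfect if it is nondegenerate on closed fibres. -/
lemma isPerfPair_of_forall_nondegenerate [Module.Finite A R] [Module.Projective A R]
    (ρ : R →ₗ[A] A) (h : ∀ (p : Ideal A) [p.IsMaximal] (s : p.Fiber R),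
      (∀ t, formBaseChange p.ResidueField ρ (s * t) = 0) → s = 0) :
    (orientationPairing ρ).IsPerfPair := by
  have hsurj : Function.Surjective (orientationPairing ρ) := by
    rw [← LinearMap.range_eq_top]
    refine Submodule.eq_top_of_forall_isMaximal _ fun p _ f _ ↦ ?_
    obtain ⟨z, hz⟩ := exists_dual_apply_eq_of_nondegenerate _ (h p) (formBaseChange p.ResidueField f)
    -- For p maximal, A → κ(p) is onto, so z lifts to R. The error f - ρ(r ·) then has values in p,
    -- and a dual basis places it in p times the dual.
    obtain ⟨r, rfl⟩ := TensorProduct.mk_surjective A R p.ResidueField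
      p.algebraMap_residueField_surjective z
    have hmem (x : R) : (f - orientationPairing ρ r) x ∈ p := by
      rw [← Ideal.algebraMap_residueField_eq_zero, LinearMap.sub_apply, map_sub, sub_eq_zero]
      have := hz (1 ⊗ₜ x)
      rwa [TensorProduct.mk_apply, Algebra.TensorProduct.tmul_mul_tmul, formBaseChange_tmul,
        formBaseChange_tmul, mul_one, one_mul, one_mul] at this
    rw [← add_sub_cancel (orientationPairing ρ r) f]
    refine Submodule.add_mem_sup ⟨r, rfl⟩ ?_
    obtain ⟨n, e, g, heg⟩ := exists_finite_dual_basis A R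
    have : f - orientationPairing ρ r = ∑ i, (f - orientationPairing ρ r) (e i) • g i := by
      ext x
      conv_lhs => rw [← heg x, map_sum]
      simp [mul_comm]
    rw [this]
    exact Submodule.sum_mem _ fun i _ ↦ Submodule.smul_mem_smul (hmem _) trivial
  have hflip : (orientationPairing ρ).flip = orientationPairing ρ := by
    ext r s
    simp [orientationPairing_apply, mul_comm]
  have hinj : Function.Injective (orientationPairing ρ) := by
    refine (injective_iff_map_eq_zero _).2 fun x hx ↦ ?_
    -- Every functional is some ρ(r ·), so x is killed by the whole dual and vanishes by
    -- projectivity.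
    refine (Module.forall_dual_apply_eq_zero_iff A x).1 fun f ↦ ?_
    obtain ⟨r, rfl⟩ := hsurj f
    rw [orientationPairing_apply, mul_comm, ← orientationPairing_apply, hx, LinearMap.zero_apply]
  exact ⟨⟨hinj, hsurj⟩, by rw [hflip]; exact ⟨hinj, hsurj⟩⟩

/-- A perfect form on a finite projective algebra is nondegenerate on all base changes. -/
lemma formBaseChange_nondegenerate_of_isPerfPair [Module.Finite A R] [Module.Projective A R]
    (ρ : R →ₗ[A] A) (h : (orientationPairing ρ).IsPerfPair) (K : Type*) [Field K] [Algebra A K]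
    (s : K ⊗[A] R) (hs : ∀ t, formBaseChange K ρ (s * t) = 0) : s = 0 := by
  obtain ⟨n, e, g, heg⟩ := exists_finite_dual_basis A R
  -- Writing the dual basis as g i = ρ(c i ·) gives z = ∑ ρ(z c_i) e_i, an identity that survives
  -- base change.
  choose c hc using fun i ↦ h.bijective_left.surjective (g i)
  have key (z : K ⊗[A] R) : ∑ i, formBaseChange K ρ (z * 1 ⊗ₜ c i) • (1 : K) ⊗ₜ[A] e i = z := by
    induction z with
    | zero => simp
    | add x y hx hy => simp only [add_mul, map_add, add_smul, Finset.sum_add_distrib, hx, hy]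
    | tmul a r =>
      conv_rhs => rw [← heg r, tmul_sum]
      refine Finset.sum_congr rfl fun i _ ↦ ?_
      rw [Algebra.TensorProduct.tmul_mul_tmul, formBaseChange_tmul, mul_one, smul_tmul',
        ← smul_tmul, smul_eq_mul, mul_one, ← hc, orientationPairing_apply, mul_comm r,
        Algebra.smul_def, mul_comm]
  rw [← key s]
  exact Finset.sum_eq_zero fun i _ ↦ by rw [hs, zero_smul]

lemma IsArtinianGorensteinAlgebra.of_satisfiesPoincareDuality [IsNoetherianRing A]
    [Module.Finite A R] [Module.Flat A R] (𝒜 : ℕ → Submodule A R)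
    (h : SatisfiesPoincareDuality 𝒜) : IsArtinianGorensteinAlgebra A R := by
  obtain ⟨d, ρ, -, hρ⟩ := h
  have : Module.Projective A R :=
    have := Module.finitePresentation_of_finite A R
    Module.Flat.projective_of_finitePresentation
  exact ⟨inferInstance, inferInstance, fun p _ ↦ .of_nondegenerate (k := p.ResidueField) _
    (formBaseChange_nondegenerate_of_isPerfPair ρ hρ p.ResidueField)⟩

lemma IsArtinianGorensteinAlgebra.satisfiesPoincareDuality [IsNoetherianRing A] [Nontrivial A]
    (hA : IsLineBundleTrivial.{u, v} A) (𝒜 : ℕ → Submodule A R) [GradedAlgebra 𝒜]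
    (h_zero : Function.Bijective (algebraMap A (𝒜 0)))
    (h : IsArtinianGorensteinAlgebra A R) : SatisfiesPoincareDuality 𝒜 := by
  obtain ⟨_, _, hG⟩ := h
  have : Module.Projective A R :=
    have := Module.finitePresentation_of_finite A R
    Module.Flat.projective_of_finitePresentation
  have : IsNoetherianRing R := IsNoetherianRing.of_finite A R
  have : Nontrivial (𝒜 0) := h_zero.injective.nontrivial
  obtain ⟨d, _, hd⟩ := exists_top_degree 𝒜
  have : Module.Projective A (𝒜 d) :=
    .of_split (𝒜 d).subtype (gradedComponent 𝒜 d) (gradedComponent_comp_subtype 𝒜 d)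
  have hfib (p : Ideal A) [p.IsPrime] : Nontrivial (p.Fiber (𝒜 d)) := hA.nontrivial_fiber _ p
  obtain ⟨e⟩ := hA.nonempty_linearEquiv (𝒜 d) fun p _ ↦
    have := hfib p
    finrank_fiber_top_degree_eq_one 𝒜 h_zero.surjective hd (hG p)
  refine ⟨d, e.toLinearMap ∘ₗ gradedComponent 𝒜 d, fun i hi r hr ↦ ?_, ?_⟩
  · rw [LinearMap.comp_apply, gradedComponent_of_ne 𝒜 hi hr, map_zero]
  · refine isPerfPair_of_forall_nondegenerate _ fun p _ ↦ ?_
    have := hfib p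
    exact formBaseChange_nondegenerate 𝒜 h_zero.surjective hd (hG p) e

lemma satisfiesPoincareDuality_of_subsingleton [Subsingleton A] (𝒜 : ℕ → Submodule A R) :
    SatisfiesPoincareDuality 𝒜 := by
  have : Subsingleton R := Module.subsingleton A R
  refine ⟨0, 0, fun _ _ _ _ ↦ rfl, ⟨?_, ?_⟩⟩ <;>
    exact ⟨Function.injective_of_subsingleton _, Function.surjective_to_subsingleton _⟩

end Pairing

theorem mainTheorem8 {A : Type u} {R : Type v} [CommRing A] [IsNoetherianRing A]
    [CommRing R] [Algebra A R] [Algebra.FiniteType A R]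
    (𝒜 : ℕ → Submodule A R) [GradedAlgebra 𝒜]
    (h_zero : Function.Bijective (algebraMap A (𝒜 0)))
    (hA : (IsDomain A ∧ IsPrincipalIdealRing A) ∨
      (∃ (k : Type u) (_ : Field k) (n : ℕ), Nonempty (A ≃+* MvPolynomial (Fin n) k)) ∨
      (∀ (P : Type u) [AddCommGroup P] [Module A P],
        Module.Finite A P → Module.Projective A P → Module.Free A P)) :
    IsArtinianGorensteinAlgebra A R ↔
      Module.Finite A R ∧ Module.Flat A R ∧ SatisfiesPoincareDuality 𝒜 := by
  refine ⟨fun h ↦ ⟨h.1, h.2.1, ?_⟩, fun ⟨_, _, h⟩ ↦ .of_satisfiesPoincareDuality 𝒜 h⟩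
  -- Over the zero ring there is no nonzero top degree, so this case is separate.
  cases subsingleton_or_nontrivial A
  · exact satisfiesPoincareDuality_of_subsingleton 𝒜
  refine h.satisfiesPoincareDuality ?_ 𝒜 h_zero
  obtain ⟨_, _⟩ | ⟨k, _, n, ⟨e⟩⟩ | hfree := hA
  · exact .of_uniqueFactorizationMonoid
  · have : IsDomain A := e.toMulEquiv.isDomain _
    have : UniqueFactorizationMonoid A :=
      e.symm.toMulEquiv.uniqueFactorizationMonoid inferInstance
    exact .of_uniqueFactorizationMonoid
  · exact .of_forall_free hfree
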